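/- Let $n\ge 1$, let $\mathbb{Z}^n$ carry the right lexicographic order ($a<b$ iff for some $i$ one has $a_i<b_i$ and $a_j=b_j$ for all $j>i$), and write $1=(1,0,\dots,0)$. For $k\le n$ let $\mathbb{Z}^k\subseteq\mathbb{Z}^n$ be the subgroup of the $a$ with $a_i=0$ for $i>k$. **Words.** Let $X$ be a set. A $\mathbb{Z}^n$-word is a function $w:[1,\alpha]\to X^{\pm}$ with $\alpha\ge 0$ in $\mathbb{Z}^n$; $|w|=\alpha$ is its length. It is reduced if $w(\beta+1)\ne w(\beta)^{-1}$ for $1\le\beta<|w|$; $R(\mathbb{Z}^n,X)$ is the set of reduced words. Concatenation and inversion are defined as for finite words. The word $c=\mathrm{com}(u,v)$ is the longest common initial segment of $u,v$ if $u=cu'$, $v=cv'$ and $u',v'$ do not begin with the same letter; it need not exist. If $c=\mathrm{com}(u^{-1},v)$ exists, with $u^{-1}=cu'$ and $v=cv'$, put $u*v=u'^{-1}v'$. $CDR(\mathbb{Z}^n,X)$ is the set of reduced words of the form $c^{-1}uc$ with $c,u$ reduced and $u$ cyclically reduced ($u$ is empty or $u(1)^{-1}\neq u(|u|)$). **The group.**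 Let $G$ be a finitely generated non-abelian subgroup of $CDR(\mathbb{Z}^n,X)$ (so $*$ is defined on $G$, and $G$ is closed under $*$ and inversion). Assume that $G$ is irreducible, i.e. there are no $k<n$ and $u\in R(\mathbb{Z}^n,X)$ such that all products $u^{-1}*g*u$, $g\in G$, are defined and form a subgroup of $CDR(\mathbb{Z}^k,X)$. **The tree.** Let $\Gamma_G$ be the universal $\mathbb{Z}^n$-tree of $G$: its vertices are the classes $\langle\alpha,g\rangle$ of pairs $(\alpha,g)$, $g\in G$, $0\le\alpha\le|g|$, where $(\alpha,f)\sim(\beta,g)$ iff $\alpha=\beta\le|\mathrm{com}(f,g)|$, so that a vertex is an initial segment $u$ of an element of $G$. The base point is $\varepsilon=\langle 0,1\rangle$, the metric is $d(u,v)=|u|+|v|-2|\mathrm{com}(u,v)|\in\mathbb{Z}^n$, and $g\in G$ acts by $g\cdot u=g*u$. A $\mathbb{Z}^k$-subtree is a class of the relation $d(u,v)\in\mathbb{Z}^k$. **The compactification.** Let $\overline\Gamma_G=\Gamma_G\cup\bigcup_{k=1}^n\partial_k\Gamma_G$, where $\partial_k\Gamma_G$ is the set of ends of $\mathbb{Z}^k$-type,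 i.e. of classes of isometries $[0,\infty)_{\mathbb{Z}^k}\to\Gamma_G$, two of them being equivalent if their images have a common tail, and where for $k<n$ the two facing ends of adjacent $\mathbb{Z}^k$-subtrees are identified. So the points of $\overline\Gamma_G$ correspond to the linear subtrees of $\Gamma_G$ starting at $\varepsilon$: $v\mapsto[\varepsilon,v]$ for vertices and $a\mapsto[\varepsilon,a)$ for ends. $G$ acts on $\overline\Gamma_G$. Choose a base vertex $w_S$ in each $\mathbb{Z}$-subtree $S$, and real numbers $c_S>0$ with $\sum_S c_S<\infty$. Give $\overline\Gamma_G$ the topology of the metric $$d_{\overline\Gamma_G}(p,q)=\sum_{S\cap[p,q]\ne\varnothing}c_S\,e^{-d(w_S,\,S\cap[p,q])}\quad(p\ne q),\qquad d_{\overline\Gamma_G}(p,p)=0,$$ where $[p,q]$ is the set of the vertices of the geodesic between $p$ and $q$. **Statement.** Let $\mu$ be a probability measure on $G$ whose support generates $G$ as a semigroup, and let $\nu_\mu$ be a $\mu$-stationary Borel probability measure on $\overline\Gamma_G$, i.e. $\sum_{g}\mu(g)\,(g\cdot\nu_\mu)=\nu_\mu$ with $(g\cdot\nu_\mu)(E)=\nu_\mu(g^{-1}E)$.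 Let $\omega\in\partial_n\Gamma_G$ be an end of $\mathbb{Z}^n$-type, and let $(g_i)$ be a sequence in $G$ such that $g_i\cdot\nu_\mu$ converges weakly to the Dirac measure $\delta_\omega$. Then for every vertex $x$ of $\Gamma_G$ the sequence $g_i\cdot x$ converges to $\omega$ in $\overline\Gamma_G$. -/

import Mathlib

open Filter Topology MeasureTheory
open scoped BoundedContinuousFunction

noncomputable section

/-! ### The group `ℤⁿ` with the right lexicographic order -/

/-- `ℤⁿ` with the right lexicographic order: `a < b` iff for some `i` we have `aᵢ < bᵢ` and
`aⱼ = bⱼ` for all `j > i` (see `ZLex.lt_def`). -/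
def ZLex (n : ℕ) : Type := Colex (Fin n → ℤ)

namespace ZLex

instance (n : ℕ) : AddCommGroup (ZLex n) := inferInstanceAs (AddCommGroup (Colex (Fin n → ℤ)))

instance (n : ℕ) : LinearOrder (ZLex n) := Pi.Colex.linearOrder (ι := Fin n) (β := fun _ => ℤ)

/-- The `i`-th coordinate (indices start with `0`). -/
def coord {n : ℕ} (a : ZLex n) (i : Fin n) : ℤ := ofColex a i

theorem ext_coord {n : ℕ} {a b : ZLex n} (h : ∀ i, a.coord i = b.coord i) : a = b := funext h

theorem lt_def {n : ℕ} {a b : ZLex n} :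
    a < b ↔ ∃ i, (∀ j, i < j → a.coord j = b.coord j) ∧ a.coord i < b.coord i := Iff.rfl

@[simp] theorem coord_zero {n : ℕ} (i : Fin n) : (0 : ZLex n).coord i = 0 := rfl

@[simp] theorem coord_add {n : ℕ} (a b : ZLex n) (i : Fin n) :
    (a + b).coord i = a.coord i + b.coord i := rfl

instance instIsOrderedAddMonoid (n : ℕ) : IsOrderedAddMonoid (ZLex n) where
  add_le_add_left a b h c := by
    rcases h.lt_or_eq with h | rfl
    · obtain ⟨i, hi, hlt⟩ := lt_def.1 h
      refine le_of_lt (lt_def.2 ⟨i, fun j hj => ?_, ?_⟩)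
      · rw [coord_add, coord_add, hi j hj]
      · rw [coord_add, coord_add]
        omega
    · exact le_rfl

/-- The smallest positive element `(1, 0, …, 0)` of `ℤⁿ`, written `1` for words. (The numeral `1`
of Mathlib would be `(1, …, 1)`.) -/
def unit (n : ℕ) [NeZero n] : ZLex n := toColex (Pi.single 0 1)

theorem coord_unit_zero {n : ℕ} [NeZero n] : (unit n).coord 0 = 1 :=
  Pi.single_eq_same (M := fun _ : Fin n => ℤ) 0 1

theorem coord_unit_of_ne {n : ℕ} [NeZero n] {i : Fin n} (h : i ≠ 0) : (unit n).coord i = 0 :=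
  Pi.single_eq_of_ne (M := fun _ : Fin n => ℤ) h 1

theorem unit_le_iff {n : ℕ} [NeZero n] {a : ZLex n} : unit n ≤ a ↔ 0 < a := by
  constructor
  · intro h
    refine lt_of_lt_of_le (lt_def.2 ⟨0, fun j hj => ?_, ?_⟩) h
    · rw [coord_zero, coord_unit_of_ne (ne_of_gt hj)]
    · rw [coord_zero, coord_unit_zero]
      exact one_pos
  · intro h
    obtain ⟨i, hi, hlt⟩ := lt_def.1 h
    simp only [coord_zero] at hi hlt
    by_cases h0 : i = 0
    · subst h0
      by_cases h1 : a.coord 0 = 1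
      · refine le_of_eq (ext_coord fun j => ?_)
        by_cases hj : j = 0
        · rw [hj, h1, coord_unit_zero]
        · rw [coord_unit_of_ne hj, hi j (Fin.pos_iff_ne_zero.2 hj)]
      · refine le_of_lt (lt_def.2 ⟨0, fun j hj => ?_, ?_⟩)
        · rw [coord_unit_of_ne (ne_of_gt hj), hi j hj]
        · rw [coord_unit_zero]
          omega
    · refine le_of_lt (lt_def.2 ⟨i, fun j hj => ?_, ?_⟩)
      · rw [coord_unit_of_ne, hi j hj]
        rintro rfl
        exact absurd hj (not_lt.2 (Fin.zero_le i))
      · rw [coord_unit_of_ne h0]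
        exact hlt

/-- The convex subgroup `ℤᵏ` of `ℤⁿ`: the coordinates with (zero-based) index `≥ k` vanish. -/
def convexSubgroup (n k : ℕ) : Set (ZLex n) := {a | ∀ i : Fin n, k ≤ (i : ℕ) → a.coord i = 0}

end ZLex

/-! ### `ℤⁿ`-words -/

/-- A `ℤⁿ`-word over `X`: a function `[1, α] → X^±` with `α ≥ 0`, where `1 = (1, 0, …, 0)`. It is
written as a partial function (`none` off the segment `[1, α]`); `(x, true)` is the letter `x` and
`(x, false)` the letter `x⁻¹`. -/
@[ext]
structure ZWord (n : ℕ) [NeZero n] (X : Type*) where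
  len : ZLex n
  letter : ZLex n → Option (X × Bool)
  len_nonneg : 0 ≤ len
  isSome_iff : ∀ γ, (letter γ).isSome = true ↔ ZLex.unit n ≤ γ ∧ γ ≤ len

namespace ZWord

variable {n : ℕ} [NeZero n] {X : Type*}

/-- Inversion of letters. -/
def flip (x : X × Bool) : X × Bool := (x.1, !x.2)

theorem letter_eq_none {w : ZWord n X} {γ : ZLex n} (h : ¬ (ZLex.unit n ≤ γ ∧ γ ≤ w.len)) :
    w.letter γ = none := by
  have := mt (w.isSome_iff γ).1 h
  simpa using this

/-- The empty word `ε`. -/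
def nil : ZWord n X where
  len := 0
  letter _ := none
  len_nonneg := le_rfl
  isSome_iff γ := by
    simp only [Option.isSome_none, Bool.false_eq_true, false_iff, not_and]
    intro h h'
    exact absurd (ZLex.unit_le_iff.1 h) (not_lt.2 h')

/-- Concatenation `u v` of words. -/
def concat (u v : ZWord n X) : ZWord n X where
  len := u.len + v.len
  letter γ := if γ ≤ u.len then u.letter γ else v.letter (γ - u.len)
  len_nonneg := add_nonneg u.len_nonneg v.len_nonneg
  isSome_iff γ := by
    split_ifs with h
    · rw [u.isSome_iff]
      exact and_congr_right fun _ =>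
        ⟨fun h' => h'.trans (le_add_of_nonneg_right v.len_nonneg), fun _ => h⟩
    · rw [v.isSome_iff, ZLex.unit_le_iff, ZLex.unit_le_iff, sub_pos, sub_le_iff_le_add']
      push Not at h
      exact and_congr_left fun _ => ⟨fun _ => u.len_nonneg.trans_lt h, fun _ => h⟩

/-- The inverse word, `w⁻¹(β) = w(|w| + 1 - β)⁻¹`. -/
def inv (w : ZWord n X) : ZWord n X where
  len := w.len
  letter γ := (w.letter (w.len + ZLex.unit n - γ)).map flip
  len_nonneg := w.len_nonneg
  isSome_iff γ := by
    rw [Option.isSome_map, w.isSome_iff, sub_le_iff_le_add, le_sub_iff_add_le]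
    constructor
    · rintro ⟨h1, h2⟩
      exact ⟨le_of_add_le_add_left h2, by rw [add_comm] at h1; exact le_of_add_le_add_right h1⟩
    · rintro ⟨h1, h2⟩
      exact ⟨by rw [add_comm]; gcongr, by gcongr⟩

/-- `w` is reduced: `w(β + 1) ≠ w(β)⁻¹` whenever `1 ≤ β < |w|`. -/
def IsReduced (w : ZWord n X) : Prop :=
  ∀ β, ZLex.unit n ≤ β → β < w.len → w.letter (β + ZLex.unit n) ≠ (w.letter β).map flip

/-- `u` is the initial segment of `w` of length `|u|`. -/
def IsPrefix (u w : ZWord n X) : Prop :=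
  u.len ≤ w.len ∧ ∀ γ, γ ≤ u.len → u.letter γ = w.letter γ

/-- The words `u`, `v` do not begin with the same letter (an empty word begins with no letter). -/
def Diverge (u v : ZWord n X) : Prop :=
  ∀ x, u.letter (ZLex.unit n) = some x → v.letter (ZLex.unit n) ≠ some x

/-- `c` is the longest common initial segment `com(u, v)`. -/
def IsCom (u v c : ZWord n X) : Prop :=
  ∃ u' v' : ZWord n X, u = c.concat u' ∧ v = c.concat v' ∧ Diverge u' v'

/-- `w` is the product `u ∗ v`: `u⁻¹ = c ∘ u'` and `v = c ∘ v'` with `c = com(u⁻¹, v)`, and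
`w = u'⁻¹ ∘ v'`. This is a partial operation. -/
def IsProd (u v w : ZWord n X) : Prop :=
  ∃ c u' v' : ZWord n X, u.inv = c.concat u' ∧ v = c.concat v' ∧ Diverge u' v' ∧ w = u'.inv.concat v'

/-- `w` is cyclically reduced: `w(1)⁻¹ ≠ w(|w|)` (no condition on the empty word). -/
def IsCyclicallyReduced (w : ZWord n X) : Prop :=
  ∀ x, w.letter (ZLex.unit n) = some x → w.letter w.len ≠ some (flip x)

/-- `w ∈ CDR(ℤⁿ, X)`: `w` is reduced and `w = c⁻¹ ∘ u ∘ c` with `c`, `u` reduced and `u` cyclically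
reduced. -/
def IsCDR (w : ZWord n X) : Prop :=
  w.IsReduced ∧ ∃ c u : ZWord n X, c.IsReduced ∧ u.IsReduced ∧ u.IsCyclicallyReduced ∧
    w = (c.inv.concat u).concat c

/-! Elementary facts on words, used to see that the tree and the action below are well defined. -/

theorem nil_concat (u : ZWord n X) : nil.concat u = u := by
  refine ZWord.ext (zero_add _) (funext fun γ => ?_)
  change (if γ ≤ 0 then none else u.letter (γ - 0)) = u.letter γ
  split_ifs with h
  · rw [letter_eq_none]
    rintro ⟨h1, -⟩
    exact absurd (ZLex.unit_le_iff.1 h1) (not_lt.2 h)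
  · rw [sub_zero]

theorem concat_nil (u : ZWord n X) : u.concat nil = u := by
  refine ZWord.ext (add_zero _) (funext fun γ => ?_)
  change (if γ ≤ u.len then u.letter γ else none) = u.letter γ
  split_ifs with h
  · rfl
  · rw [letter_eq_none]
    exact fun h' => h h'.2

theorem concat_assoc (u v w : ZWord n X) :
    (u.concat v).concat w = u.concat (v.concat w) := by
  refine ZWord.ext (add_assoc _ _ _) (funext fun γ => ?_)
  change (if γ ≤ u.len + v.len then (if γ ≤ u.len then u.letter γ else v.letter (γ - u.len))
      else w.letter (γ - (u.len + v.len))) =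
    if γ ≤ u.len then u.letter γ else
      if γ - u.len ≤ v.len then v.letter (γ - u.len) else w.letter (γ - u.len - v.len)
  have hv := v.len_nonneg
  by_cases h1 : γ ≤ u.len
  · rw [if_pos (h1.trans (le_add_of_nonneg_right hv)), if_pos h1, if_pos h1]
  · rw [if_neg h1, if_neg h1]
    simp only [sub_le_iff_le_add', sub_sub]

theorem flip_flip (x : X × Bool) : flip (flip x) = x := by
  simp [flip]

theorem inv_inv (w : ZWord n X) : w.inv.inv = w := by
  refine ZWord.ext rfl (funext fun γ => ?_)
  change ((w.letter (w.len + ZLex.unit n - (w.len + ZLex.unit n - γ))).map flip).map flip = _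
  rw [sub_sub_cancel, Option.map_map]
  have : (flip ∘ flip : X × Bool → X × Bool) = id := funext flip_flip
  rw [this, Option.map_id, id]

theorem inv_concat (u v : ZWord n X) : (u.concat v).inv = v.inv.concat u.inv := by
  refine ZWord.ext (add_comm _ _) (funext fun γ => ?_)
  change (if u.len + v.len + ZLex.unit n - γ ≤ u.len then
      u.letter (u.len + v.len + ZLex.unit n - γ)
      else v.letter (u.len + v.len + ZLex.unit n - γ - u.len)).map flip =
    if γ ≤ v.len then (v.letter (v.len + ZLex.unit n - γ)).map flip
      else (u.letter (u.len + ZLex.unit n - (γ - v.len))).map flip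
  have key : u.len + v.len + ZLex.unit n - γ ≤ u.len ↔ ¬ γ ≤ v.len := by
    rw [not_le, ← sub_pos, ← ZLex.unit_le_iff, sub_le_iff_le_add, add_assoc,
      add_le_add_iff_left, le_sub_iff_add_le, add_comm]
  by_cases h : γ ≤ v.len
  · rw [if_neg (by rw [key]; exact not_not.2 h), if_pos h]
    congr 2
    abel
  · rw [if_pos (key.2 h), if_neg h]
    congr 2
    abel

theorem IsPrefix.refl (u : ZWord n X) : u.IsPrefix u := ⟨le_rfl, fun _ _ => rfl⟩

theorem IsPrefix.trans {u v w : ZWord n X} (h : u.IsPrefix v) (h' : v.IsPrefix w) :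
    u.IsPrefix w :=
  ⟨h.1.trans h'.1, fun γ hγ => (h.2 γ hγ).trans (h'.2 γ (hγ.trans h.1))⟩

theorem nil_isPrefix (u : ZWord n X) : nil.IsPrefix u :=
  ⟨u.len_nonneg, fun _ hγ => (letter_eq_none fun h =>
    absurd (ZLex.unit_le_iff.1 h.1) (not_lt.2 hγ)).symm⟩

theorem isPrefix_concat (u v : ZWord n X) : u.IsPrefix (u.concat v) :=
  ⟨le_add_of_nonneg_right v.len_nonneg, fun _ hγ => (if_pos hγ).symm⟩

theorem IsPrefix.of_le {u v w : ZWord n X} (hu : u.IsPrefix w) (hv : v.IsPrefix w)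
    (h : u.len ≤ v.len) : u.IsPrefix v :=
  ⟨h, fun γ hγ => (hu.2 γ hγ).trans (hv.2 γ (hγ.trans h)).symm⟩

theorem IsPrefix.concat_left (u : ZWord n X) {v w : ZWord n X} (h : v.IsPrefix w) :
    (u.concat v).IsPrefix (u.concat w) := by
  refine ⟨add_le_add_right h.1 _, fun γ hγ => ?_⟩
  change (if γ ≤ u.len then _ else _) = if γ ≤ u.len then _ else _
  split_ifs with h'
  · rfl
  · exact h.2 _ (sub_le_iff_le_add'.2 hγ)

theorem IsPrefix.exists_concat {u w : ZWord n X} (h : u.IsPrefix w) : ∃ t, w = u.concat t := by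
  refine ⟨⟨w.len - u.len, fun γ => if 0 < γ then w.letter (γ + u.len) else none,
    sub_nonneg.2 h.1, fun γ => ?_⟩, ?_⟩
  · split_ifs with h0
    · rw [w.isSome_iff, ZLex.unit_le_iff, ZLex.unit_le_iff, le_sub_iff_add_le]
      exact and_congr_left fun _ =>
        ⟨fun _ => h0, fun _ => add_pos_of_pos_of_nonneg h0 u.len_nonneg⟩
    · rw [ZLex.unit_le_iff]
      simp [h0]
  · refine ZWord.ext (by simp [concat]) (funext fun γ => ?_)
    change w.letter γ = if γ ≤ u.len then u.letter γ else
      if 0 < γ - u.len then w.letter (γ - u.len + u.len) else none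
    split_ifs with h1 h2
    · exact (h.2 γ h1).symm
    · rw [sub_add_cancel]
    · exact absurd (sub_pos.2 (not_le.1 h1)) h2

theorem isPrefix_of_concat_isPrefix_concat {c u v : ZWord n X}
    (h : (c.concat u).IsPrefix (c.concat v)) : u.IsPrefix v := by
  refine ⟨le_of_add_le_add_left h.1, fun γ hγ => ?_⟩
  by_cases h0 : 0 < γ
  · have h1 : ¬ γ + c.len ≤ c.len := by
      rw [not_le]
      exact lt_add_of_pos_left _ h0
    have h2 := h.2 (γ + c.len) (by
      rw [add_comm]
      exact add_le_add_right hγ _)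
    change (if γ + c.len ≤ c.len then _ else u.letter (γ + c.len - c.len)) =
      (if γ + c.len ≤ c.len then _ else v.letter (γ + c.len - c.len)) at h2
    rwa [if_neg h1, if_neg h1, add_sub_cancel_right] at h2
  · rw [letter_eq_none fun h' => h0 (ZLex.unit_le_iff.1 h'.1),
      letter_eq_none fun h' => h0 (ZLex.unit_le_iff.1 h'.1)]

theorem nil_diverge (v : ZWord n X) : Diverge nil v := by
  intro x hx
  exact absurd hx (by simp [nil])

theorem Diverge.symm {u v : ZWord n X} (h : Diverge u v) : Diverge v u :=
  fun x hv hu => h x hu hv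

theorem Diverge.of_isPrefix {u v w : ZWord n X} (h : Diverge v w) (hu : u.IsPrefix v) :
    Diverge u w := by
  intro x hx
  refine h x ?_
  rw [← hx, hu.2]
  exact ((u.isSome_iff _).1 (by rw [hx]; rfl)).2

theorem IsCom.symm {u v c : ZWord n X} (h : IsCom u v c) : IsCom v u c := by
  obtain ⟨a, b, ha, hb, hd⟩ := h
  exact ⟨b, a, hb, ha, hd.symm⟩

theorem IsCom.exists_of_isPrefix {u v w c : ZWord n X} (h : IsCom v w c) (hu : u.IsPrefix v) :
    ∃ d, IsCom u w d := by
  obtain ⟨a, b, rfl, rfl, hd⟩ := h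
  rcases le_total u.len c.len with hl | hl
  · obtain ⟨t, rfl⟩ := (hu.of_le (isPrefix_concat c a) hl).exists_concat
    exact ⟨u, nil, t.concat b, (concat_nil u).symm, concat_assoc _ _ _, nil_diverge _⟩
  · obtain ⟨t, rfl⟩ := ((isPrefix_concat c a).of_le hu hl).exists_concat
    exact ⟨c, t, b, rfl, rfl, hd.of_isPrefix (isPrefix_of_concat_isPrefix_concat hu)⟩

end ZWord

/-! ### Subgroups of `CDR(ℤⁿ, X)` -/

/-- An identification of the group `G` with a subgroup of `CDR(ℤⁿ, X)`: an injective map to words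
from `CDR(ℤⁿ, X)` under which the multiplication of `G` is the product `∗` (which thus is defined
for all pairs of elements) and inversion is inversion of words. -/
structure CDRSubgroup (n : ℕ) [NeZero n] (X : Type*) (G : Type*) [Group G] where
  word : G → ZWord n X
  injective : Function.Injective word
  isCDR : ∀ g, (word g).IsCDR
  map_mul : ∀ f g, ZWord.IsProd (word f) (word g) (word (f * g))
  map_inv : ∀ g, word g⁻¹ = (word g).inv

namespace CDRSubgroup

variable {n : ℕ} [NeZero n] {X : Type*} {G : Type*} [Group G]

/-- `G` is reducible if for some `k < n` it is conjugate, by an element `u` of `R(ℤⁿ, X)`, to a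
subgroup of `CDR(ℤᵏ, X)`: the products `u⁻¹ ∗ g ∗ u`, `g ∈ G`, are defined and make up a subgroup
of `CDR(ℤⁿ, X)` all of whose elements have length in `ℤᵏ`. Otherwise `G` is irreducible. -/
def IsIrreducible (φ : CDRSubgroup n X G) : Prop :=
  ¬ ∃ k < n, ∃ u : ZWord n X, u.IsReduced ∧ ∃ ψ : CDRSubgroup n X G,
    (∀ g, (ψ.word g).len ∈ ZLex.convexSubgroup n k) ∧
    ∀ g, ∃ w, ZWord.IsProd u.inv (φ.word g) w ∧ ZWord.IsProd w u (ψ.word g)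

/-! ### The universal tree `Γ_G` -/

/-- The vertices of the universal `ℤⁿ`-tree `Γ_G`. By construction, `Γ_G` is the set of pairs
`(α, g)` with `g ∈ G` and `0 ≤ α ≤ |g|`, modulo `(α, f) ~ (β, g)` iff `α = β ≤ c(f, g)`, i.e. iff
the initial segments of length `α` of `f` and of length `β` of `g` are the same word. So the
class `⟨α, g⟩` is recorded as that initial segment. -/
def Tree (φ : CDRSubgroup n X G) : Type _ := {u : ZWord n X // ∃ g, u.IsPrefix (φ.word g)}

variable {φ : CDRSubgroup n X G}

/-- The base point `ε`. -/
def Tree.base (φ : CDRSubgroup n X G) : φ.Tree := ⟨ZWord.nil, 1, ZWord.nil_isPrefix _⟩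

/-- `u ≤ v` iff `u` lies on the segment `[ε, v]`. -/
def Tree.Below (u v : φ.Tree) : Prop := u.1.IsPrefix v.1

theorem Tree.exists_isCom (u v : φ.Tree) : ∃ c, ZWord.IsCom u.1 v.1 c := by
  obtain ⟨u, f, hu⟩ := u
  obtain ⟨v, g, hv⟩ := v
  obtain ⟨c, a, b, ha, hb, hd, -⟩ := φ.map_mul f⁻¹ g
  rw [φ.map_inv, ZWord.inv_inv] at ha
  obtain ⟨d, hd⟩ := (show ZWord.IsCom (φ.word f) (φ.word g) c from
    ⟨a, b, ha, hb, hd⟩).exists_of_isPrefix hu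
  obtain ⟨e, he⟩ := hd.symm.exists_of_isPrefix hv
  exact ⟨e, he.symm⟩

/-- The `ℤⁿ`-valued metric `d(u, v) = |u| + |v| - 2 c(u, v)` of `Γ_G`. -/
def Tree.dist (u v : φ.Tree) : ZLex n :=
  u.1.len + v.1.len - 2 • (u.exists_isCom v).choose.len

theorem Tree.exists_isProd (f : G) (u : φ.Tree) :
    ∃ w : φ.Tree, ZWord.IsProd (φ.word f) u.1 w.1 := by
  obtain ⟨u, g, hu⟩ := u
  obtain ⟨c, a, b, ha, hb, hd, hw⟩ := φ.map_mul f g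
  rw [hb] at hu
  rcases le_total u.len c.len with hl | hl
  · obtain ⟨t, rfl⟩ := (hu.of_le (ZWord.isPrefix_concat c b) hl).exists_concat
    rw [ZWord.concat_assoc] at ha
    have hp : ZWord.IsProd (φ.word f) u (t.concat a).inv :=
      ⟨u, t.concat a, ZWord.nil, ha, (ZWord.concat_nil u).symm, (ZWord.nil_diverge _).symm,
        (ZWord.concat_nil _).symm⟩
    refine ⟨⟨(t.concat a).inv, f, ?_⟩, hp⟩
    rw [← ZWord.inv_inv (φ.word f), ha, ZWord.inv_concat u (t.concat a)]
    exact ZWord.isPrefix_concat (t.concat a).inv u.inv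
  · obtain ⟨t, rfl⟩ := ((ZWord.isPrefix_concat c b).of_le hu hl).exists_concat
    have ht := ZWord.isPrefix_of_concat_isPrefix_concat hu
    refine ⟨⟨a.inv.concat t, f * g, ?_⟩, c, a, t, ha, rfl, (hd.symm.of_isPrefix ht).symm, rfl⟩
    rw [hw]
    exact ht.concat_left _

/-- The action of `G` on `Γ_G`. If `α ≤ c(f⁻¹, g)` then `f` maps `⟨α, g⟩` to `⟨|f| - α, f⟩`, and
otherwise to `⟨|f| + α - 2 c(f⁻¹, g), f ∗ g⟩`; in both cases, this is the product `f ∗ u` of `f`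
and the initial segment `u = ⟨α, g⟩`. -/
instance : SMul G φ.Tree := ⟨fun f u => (Tree.exists_isProd f u).choose⟩

/-! ### The compactification `Γ̄_G` as a set -/

/-- The points of `Γ̄_G = Γ_G ∪ ∂Γ_G`, each of them given by the linear subtree that joins the base
point `ε` to it: the vertex `v` by the closed segment `[ε, v]` and the end `a` by the geodesic ray
`[ε, a)`. A linear subtree from `ε` that has no last vertex defines an end of `ℤᵏ`-type for exactly
one `k ∈ {1, …, n}`. Each end is obtained in this way, and two ends have the same ray from `ε` iff
they are equal or are the two facing ends of `ℤᵏ`-type of adjacent `ℤᵏ`-subtrees, and these are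
identified in `Γ̄_G`. -/
@[ext]
structure Completion (φ : CDRSubgroup n X G) where
  carrier : Set φ.Tree
  base_mem : Tree.base φ ∈ carrier
  mem_of_below : ∀ u v, u.Below v → v ∈ carrier → u ∈ carrier
  linear : ∀ u ∈ carrier, ∀ v ∈ carrier, u.Below v ∨ v.Below u

/-- The embedding `Γ_G → Γ̄_G`, `v ↦ [ε, v]`. -/
def Completion.ofVertex (v : φ.Tree) : φ.Completion where
  carrier := {u | u.Below v}
  base_mem := ZWord.nil_isPrefix _
  mem_of_below _ _ h h' := h.trans h'
  linear u hu w hw := (le_total u.1.len w.1.len).imp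
    (ZWord.IsPrefix.of_le hu hw) (ZWord.IsPrefix.of_le hw hu)

/-- `p` is an end of `ℤᵏ`-type: beyond some vertex `v`, the ray `[ε, p)` is the image of an isometry
`[0, ∞)_{ℤᵏ} → Γ_G` that starts at `v`. (Used for `1 ≤ k ≤ n`.) -/
def Completion.IsEndOfType (k : ℕ) (p : φ.Completion) : Prop :=
  ∃ v ∈ p.carrier, ∃ r : {a : ZLex n // 0 ≤ a ∧ a ∈ ZLex.convexSubgroup n k} → φ.Tree,
    (∀ a b, (r a).dist (r b) = |a.1 - b.1|) ∧ (∀ a, a.1 = 0 → r a = v) ∧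
    Set.range r = {u | u ∈ p.carrier ∧ v.Below u}

/-- The action of `G` on `Γ̄_G`: a vertex `z` lies on `[ε, g · p)` iff it lies on `[ε, g · y]` for
all `y` on `[ε, p)` from some vertex on. For `p` a vertex `v`, this gives `[ε, g · v]`. -/
instance : SMul G φ.Completion where
  smul g p :=
    { carrier := {z | ∃ y₀ ∈ p.carrier, ∀ y ∈ p.carrier, y₀.Below y → z.Below (g • y)}
      base_mem := ⟨_, p.base_mem, fun _ _ _ => ZWord.nil_isPrefix _⟩
      mem_of_below := by
        rintro u v h ⟨y₀, hy₀, H⟩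
        exact ⟨y₀, hy₀, fun y hy hy' => h.trans (H y hy hy')⟩
      linear := by
        rintro u ⟨y, hy, Hu⟩ w ⟨z, hz, Hw⟩
        obtain ⟨x, hx, hyx, hzx⟩ : ∃ x ∈ p.carrier, y.Below x ∧ z.Below x := by
          rcases p.linear y hy z hz with h | h
          · exact ⟨z, hz, h, ZWord.IsPrefix.refl _⟩
          · exact ⟨y, hy, ZWord.IsPrefix.refl _, h⟩
        have h1 := Hu x hx hyx
        have h2 := Hw x hx hzx
        exact (le_total u.1.len w.1.len).imp
          (ZWord.IsPrefix.of_le h1 h2) (ZWord.IsPrefix.of_le h2 h1) }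

/-- The vertices of the geodesic `[p, q]` in `Γ_G` between two distinct points of `Γ̄_G`: the vertices
`z` that lie between `x` and `y`, i.e. `d(x, z) + d(z, y) = d(x, y)`, for all `x` on `[ε, p)` and all
`y` on `[ε, q)` from some vertex on. -/
def Completion.geodesic (p q : φ.Completion) : Set φ.Tree :=
  {z | ∃ x₀ ∈ p.carrier, ∃ y₀ ∈ q.carrier, ∀ x ∈ p.carrier, ∀ y ∈ q.carrier,
    x₀.Below x → y₀.Below y → x.dist z + z.dist y = x.dist y}

/-! ### The metric of `Γ̄_G` -/

/-- The `ℤ`-subtrees of `Γ_G`: the classes of vertices at distance in `ℤ¹` from each other. -/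
def ZSubtree (φ : CDRSubgroup n X G) : Type _ :=
  {S : Set φ.Tree // ∃ u : φ.Tree, S = {v | u.dist v ∈ ZLex.convexSubgroup n 1}}

/-- The choices made in the construction of the metric of `Γ̄_G`: a base vertex `w_S` in each
`ℤ`-subtree `S`, and the factor `c_S > 0` by which the metric of the compactification of `S` is
rescaled, with `∑ c_S < ∞`.

The construction goes by induction on `m ≤ n`: the metric of the compactification of a
`ℤᵐ`-subtree is put together from those of its `ℤᵐ⁻¹`-subtrees, where the subtree with index `j`
among the ones of level `i` is rescaled by `2^{-(i+j)}`. So the total factor `c_S` is the product of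
these numbers over the `ℤᵐ⁻¹`-subtrees that contain `S`, `2 ≤ m ≤ n`, and
`∑ c_S ≤ 4^{n-1}`. All positive summable families are admitted here. -/
structure MetricData (φ : CDRSubgroup n X G) where
  basePoint : φ.ZSubtree → φ.Tree
  basePoint_mem : ∀ S, basePoint S ∈ S.1
  scale : φ.ZSubtree → ℝ
  scale_pos : ∀ S, 0 < scale S
  summable_scale : Summable scale

/-- The distance in the compactification of the `ℤ`-subtree `S` of the two points at which the
geodesic `[p, q]` enters and leaves `S`: it is `e^{-(a · b)_w} = e^{-d(w, [p, q] ∩ S)}`, where `a, b`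
are these points and `w = w_S`; it is `0` if `[p, q]` does not meet `S`. -/
def Completion.distIn (D : MetricData φ) (S : φ.ZSubtree) (p q : φ.Completion) : ℝ :=
  sSup ((fun z => Real.exp (-(((D.basePoint S).dist z).coord 0 : ℝ))) '' (S.1 ∩ p.geodesic q))

open Classical in
/-- The metric of `Γ̄_G`: the rescaled distances in the compactifications of the `ℤ`-subtrees met by
`[p, q]` are added up. -/
def Completion.metric (D : MetricData φ) (p q : φ.Completion) : ℝ :=
  if p = q then 0 else ∑' S, D.scale S * Completion.distIn D S p q

/-- `Γ̄_G` with the topology of the metric given by `D`. -/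
def Compactification (φ : CDRSubgroup n X G) (_D : MetricData φ) : Type _ := φ.Completion

variable {D : MetricData φ}

instance : SMul G (φ.Compactification D) := inferInstanceAs (SMul G φ.Completion)

/-- The topology of the metric: `U` is open iff it contains a ball around each of its points. -/
instance : TopologicalSpace (φ.Compactification D) where
  IsOpen U := ∀ p ∈ U, ∃ δ > 0, ∀ q, Completion.metric D p q < δ → q ∈ U
  isOpen_univ := fun _ _ => ⟨1, one_pos, fun _ _ => trivial⟩
  isOpen_inter := by
    rintro U V hU hV p ⟨hpU, hpV⟩
    obtain ⟨δ, hδ, H⟩ := hU p hpU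
    obtain ⟨δ', hδ', H'⟩ := hV p hpV
    exact ⟨min δ δ', lt_min hδ hδ', fun q hq =>
      ⟨H q (hq.trans_le (min_le_left _ _)), H' q (hq.trans_le (min_le_right _ _))⟩⟩
  isOpen_sUnion := by
    rintro 𝒰 h𝒰 p ⟨U, hU, hp⟩
    obtain ⟨δ, hδ, H⟩ := h𝒰 U hU p hp
    exact ⟨δ, hδ, fun q hq => ⟨U, hU, H q hq⟩⟩

instance : MeasurableSpace (φ.Compactification D) := borel _

instance : BorelSpace (φ.Compactification D) := ⟨rfl⟩

/-- The embedding of `Γ_G` in `Γ̄_G`. -/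
def Compactification.ofVertex (v : φ.Tree) : φ.Compactification D := Completion.ofVertex v

/-- The set `∂_n Γ_G` of the ends of `ℤⁿ`-type. -/
def Compactification.topEnds (φ : CDRSubgroup n X G) (D : MetricData φ) :
    Set (φ.Compactification D) :=
  {p | Completion.IsEndOfType (φ := φ) n p}

/-- The translate `g · ν`, `(g · ν)(E) = ν(g⁻¹ · E)`. -/
def translate (g : G) (ν : Measure (φ.Compactification D)) : Measure (φ.Compactification D) :=
  ν.map (fun p => g • p)

/-- `ν` is `μ`-stationary: `∑_g μ(g) (g · ν) = ν`. -/
def IsStationary (μ : PMF G) (ν : Measure (φ.Compactification D)) : Prop :=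
  Measure.sum (fun g => μ g • translate g ν) = ν

/-- Weak convergence of a sequence of measures (tested on bounded continuous functions). -/
def WeaklyConverges (κ : ℕ → Measure (φ.Compactification D))
    (κ' : Measure (φ.Compactification D)) : Prop :=
  ∀ F : φ.Compactification D →ᵇ ℝ,
    Tendsto (fun i => ∫ p, F p ∂(κ i)) atTop (𝓝 (∫ p, F p ∂κ'))

end CDRSubgroup

end

/-! The shadow of a vertex `v` is the set of points whose geodesic from `ε` passes through `v`.
Shadows are clopen, and those of the vertices on `[ε, ω)` form a neighborhood base at `ω`
(`tendsto_of_eventually_mem_shadow`).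

If `g i • x` does not converge to `ω`, then for some `v₁` on `[ε, ω)` infinitely many `g i • ε` are
not beyond `v₁`. For such `i` and `v` far beyond `v₁`, the preimage under `g i` of the shadow of `v`
is the shadow of `(g i)⁻¹ • v` (`smul_mem_shadow_iff`), and this vertex is far from `ε`. By weak
convergence these shadows have `ν`-mass tending to 1. So shadows of arbitrarily long vertices have
mass close to 1, which forces `ν` to be a point mass at an end `ξ` whose ray has unbounded length
(`exists_end_of_shadows`).

Stationarity makes the support of `μ` fix `ξ` (`smul_eq_of_isStationary`). Elements fixing such an
end translate along its ray, so two of them commute on far vertices, and they commute in `G` because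
the action on the tree is free (`commute_of_smul_eq`). Hence `G` would be abelian. -/

instance ZLex.instCountable (n : ℕ) : Countable (ZLex n) :=
  inferInstanceAs (Countable (Fin n → ℤ))

/-! ### Words: common initial segments and products. -/

namespace ZWord

variable {n : ℕ} [NeZero n] {X : Type*} {c d e f m u v w a b u' v' : ZWord n X}

theorem exists_letter_unit (h : 0 < w.len) : ∃ x, w.letter (ZLex.unit n) = some x :=
  Option.isSome_iff_exists.1 ((w.isSome_iff _).2 ⟨le_rfl, ZLex.unit_le_iff.2 h⟩)

theorem len_pos_of_letter_unit {x : X × Bool} (h : w.letter (ZLex.unit n) = some x) :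
    0 < w.len :=
  ZLex.unit_le_iff.1 ((w.isSome_iff _).1 (by rw [h]; rfl)).2

theorem letter_concat_left (v : ZWord n X) {γ : ZLex n} (h : γ ≤ u.len) :
    (u.concat v).letter γ = u.letter γ := if_pos h

theorem letter_concat_right (u v : ZWord n X) {γ : ZLex n} (h : 0 < γ) :
    (u.concat v).letter (u.len + γ) = v.letter γ := by
  change (if u.len + γ ≤ u.len then _ else v.letter (u.len + γ - u.len)) = _
  rw [if_neg (not_le.2 (lt_add_of_pos_right _ h)), add_sub_cancel_left]

theorem len_concat (u v : ZWord n X) : (u.concat v).len = u.len + v.len := rfl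

theorem len_inv (u : ZWord n X) : u.inv.len = u.len := rfl

theorem IsPrefix.eq_of_len_eq (hu : u.IsPrefix w) (hv : v.IsPrefix w) (h : u.len = v.len) :
    u = v := by
  refine ZWord.ext h (funext fun γ => ?_)
  by_cases hγ : γ ≤ u.len
  · rw [hu.2 γ hγ, hv.2 γ (h ▸ hγ)]
  · rw [letter_eq_none fun h' => hγ h'.2, letter_eq_none fun h' => hγ (h ▸ h'.2)]

theorem IsPrefix.antisymm (h : u.IsPrefix v) (h' : v.IsPrefix u) : u = v :=
  h.eq_of_len_eq (IsPrefix.refl v) (le_antisymm h.1 h'.1)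

theorem eq_nil_of_len_eq_zero (h : w.len = 0) : w = nil :=
  ((nil_isPrefix w).eq_of_len_eq (IsPrefix.refl w) h.symm).symm

theorem concat_left_cancel (h : c.concat a = c.concat b) : a = b :=
  (isPrefix_of_concat_isPrefix_concat (by rw [h]; exact .refl _)).antisymm
    (isPrefix_of_concat_isPrefix_concat (by rw [h]; exact .refl _))

theorem inv_nil : (nil : ZWord n X).inv = nil := eq_nil_of_len_eq_zero rfl

theorem IsCom.isPrefix_left (h : IsCom u v c) : c.IsPrefix u := by
  obtain ⟨a, b, rfl, rfl, -⟩ := h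
  exact isPrefix_concat _ _

theorem IsCom.isPrefix_right (h : IsCom u v c) : c.IsPrefix v := h.symm.isPrefix_left

/-- In a longer common initial segment, the letter just after `c` would begin both remainders. -/
theorem IsCom.len_le (h : IsCom u v c) (hu : d.IsPrefix u) (hv : d.IsPrefix v) :
    d.len ≤ c.len := by
  obtain ⟨a, b, rfl, rfl, hd⟩ := h
  by_contra! hlt
  have h1 : c.len + ZLex.unit n ≤ d.len := by
    have : ZLex.unit n ≤ d.len - c.len := ZLex.unit_le_iff.2 (sub_pos.2 hlt)
    grind
  have hpos : 0 < ZLex.unit n := ZLex.unit_le_iff.1 le_rfl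
  have ha := hu.2 _ h1
  have hb := hv.2 _ h1
  rw [letter_concat_right _ _ hpos] at ha hb
  have hs : (d.letter (c.len + ZLex.unit n)).isSome = true :=
    (d.isSome_iff _).2 ⟨le_add_of_nonneg_left c.len_nonneg, h1⟩
  obtain ⟨x, hx⟩ := Option.isSome_iff_exists.1 hs
  exact hd x (ha ▸ hx) (hb ▸ hx)

theorem IsCom.unique (h : IsCom u v c) (h' : IsCom u v d) : c = d :=
  h.isPrefix_left.eq_of_len_eq h'.isPrefix_left
    (le_antisymm (h'.len_le h.isPrefix_left h.isPrefix_right)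
      (h.len_le h'.isPrefix_left h'.isPrefix_right))

theorem IsCom.isPrefix (h : IsCom u v c) (hu : d.IsPrefix u) (hv : d.IsPrefix v) :
    d.IsPrefix c :=
  hu.of_le h.isPrefix_left (h.len_le hu hv)

theorem IsProd.unique (h : IsProd u v w) (h' : IsProd u v m) : w = m := by
  obtain ⟨c, a, b, ha, hb, hd, rfl⟩ := h
  obtain ⟨c', a', b', ha', hb', hd', rfl⟩ := h'
  obtain rfl : c = c' := IsCom.unique ⟨a, b, ha, hb, hd⟩ ⟨a', b', ha', hb', hd'⟩
  rw [concat_left_cancel (ha.symm.trans ha'), concat_left_cancel (hb.symm.trans hb')]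

theorem isProd_nil_left (u : ZWord n X) : IsProd nil u u :=
  ⟨nil, nil, u, by rw [inv_nil, nil_concat], (nil_concat u).symm, nil_diverge u,
    by rw [inv_nil, nil_concat]⟩

theorem isProd_nil_right (u : ZWord n X) : IsProd u nil u :=
  ⟨nil, u.inv, nil, (nil_concat _).symm, (nil_concat _).symm, (nil_diverge _).symm,
    by rw [inv_inv, concat_nil]⟩

theorem isProd_inv_self (u : ZWord n X) : IsProd u.inv u nil :=
  ⟨u, nil, nil, by rw [inv_inv, concat_nil], (concat_nil _).symm, nil_diverge _,
    by rw [inv_nil, nil_concat]⟩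

theorem IsProd.exists_isCom (h : IsProd u v w) :
    ∃ c, IsCom u.inv v c ∧ w.len = u.len + v.len - 2 • c.len := by
  obtain ⟨c, a, b, ha, rfl, hd, rfl⟩ := h
  refine ⟨c, ⟨a, b, ha, rfl, hd⟩, ?_⟩
  have := congrArg len ha
  simp only [len_concat, len_inv] at this ⊢
  grind

theorem IsReduced.of_isPrefix (hw : w.IsReduced) (h : u.IsPrefix w) : u.IsReduced := by
  intro β h1 h2
  have h3 : β + ZLex.unit n ≤ u.len := by
    have : ZLex.unit n ≤ u.len - β := ZLex.unit_le_iff.2 (sub_pos.2 h2)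
    grind
  rw [h.2 _ h3, h.2 _ h2.le]
  exact hw β h1 (h2.trans_le h.1)

/-- A common first letter would give a cancelling pair at the seam, at position `|u|`. -/
theorem IsReduced.diverge_inv (h : (u.concat v).IsReduced) (hu : 0 < u.len) :
    Diverge u.inv v := by
  intro x hx hv
  have hpos : 0 < ZLex.unit n := ZLex.unit_le_iff.1 le_rfl
  refine h u.len (ZLex.unit_le_iff.2 hu) (lt_add_of_pos_right _ (len_pos_of_letter_unit hv)) ?_
  rw [letter_concat_right _ _ hpos, letter_concat_left _ le_rfl, hv, ← hx]
  change (u.letter (u.len + ZLex.unit n - ZLex.unit n)).map flip = _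
  rw [add_sub_cancel_right]

theorem Diverge.concat_right (h : Diverge u v) (hv : 0 < v.len) : Diverge u (v.concat w) := by
  intro x hx
  rw [letter_concat_left _ (ZLex.unit_le_iff.2 hv)]
  exact h x hx

/-- The longest common initial segment of `f ∗ u` and `f ∗ v`, if `f` cancels more of `v`
than of `u`. -/
theorem IsProd.isCom_of_lt (hu : IsProd f u u') (hv : IsProd f v v') (hrv : v.IsReduced)
    (hc : IsCom f.inv u c) (hd : IsCom f.inv v d) (hlt : c.len < d.len) :
    IsCom u v c ∧ ∃ m, IsCom u' v' m ∧ m.len = f.len - d.len := by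
  obtain ⟨c', a₀, b₀, ha₀, rfl, hd₀, rfl⟩ := hu
  obtain rfl := hc.unique ⟨a₀, b₀, ha₀, rfl, hd₀⟩
  obtain ⟨d', a, b, ha, rfl, hdab, rfl⟩ := hv
  obtain rfl := hd.unique ⟨a, b, ha, rfl, hdab⟩
  -- Here `d = ct`, `f⁻¹ = cta`, `u = cb₀`, `v = ctb`, so the products are `a⁻¹t⁻¹b₀` and `a⁻¹b`.
  -- They part right after `a⁻¹`, since `v` is reduced and `b` cannot begin like `t⁻¹`.
  obtain ⟨t, rfl⟩ := (hc.isPrefix_left.of_le hd.isPrefix_left hlt.le).exists_concat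
  have ht : 0 < t.len := by rw [len_concat] at hlt; grind
  obtain rfl : a₀ = t.concat a :=
    concat_left_cancel (ha₀.symm.trans (ha.trans (concat_assoc _ _ _)))
  have htb : Diverge t b₀ := hd₀.of_isPrefix (isPrefix_concat t a)
  refine ⟨⟨b₀, t.concat b, rfl, concat_assoc _ _ _, htb.symm.concat_right ht⟩, a.inv,
    ⟨t.inv.concat b₀, b, ?_, rfl, ?_⟩, ?_⟩
  · rw [inv_concat, concat_assoc]
  · have h1 := hrv.diverge_inv (c.len_nonneg.trans_lt hlt)
    rw [inv_concat] at h1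
    exact ((h1.of_isPrefix (isPrefix_concat _ _)).symm.concat_right ht).symm
  · have := congrArg len ha
    simp only [len_concat, len_inv] at this ⊢
    grind

/-- Both products replace the same `c` by the same `a⁻¹`, so what `u` and `v` share beyond `c` is
kept. -/
theorem IsProd.isCom_of_eq (hu : IsProd f u u') (hv : IsProd f v v')
    (hc : IsCom f.inv u c) (hd : IsCom f.inv v c) (hm : IsCom u v m) :
    ∃ m', IsCom u' v' m' ∧ m'.len = f.len - 2 • c.len + m.len := by
  obtain ⟨c', a, b, ha, rfl, hab, rfl⟩ := hu
  obtain rfl := hc.unique ⟨a, b, ha, rfl, hab⟩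
  obtain ⟨c', a', b', ha', rfl, hab', rfl⟩ := hv
  obtain rfl := hd.unique ⟨a', b', ha', rfl, hab'⟩
  obtain rfl := concat_left_cancel (ha.symm.trans ha')
  obtain ⟨e, rfl⟩ := (hm.isPrefix hc.isPrefix_right hd.isPrefix_right).exists_concat
  obtain ⟨x, y, hx, hy, hxy⟩ := hm
  rw [concat_assoc] at hx hy
  obtain rfl := concat_left_cancel hx
  obtain rfl := concat_left_cancel hy
  refine ⟨a.inv.concat e, ⟨x, y, (concat_assoc _ _ _).symm, (concat_assoc _ _ _).symm, hxy⟩, ?_⟩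
  have := congrArg len ha
  simp only [len_concat, len_inv] at this ⊢
  grind

/-- Together with the length formula for products, this makes left multiplication an isometry. -/
theorem IsProd.exists_isCom_len (hu : IsProd f u u') (hv : IsProd f v v')
    (hru : u.IsReduced) (hrv : v.IsReduced) (hc : IsCom f.inv u c) (hd : IsCom f.inv v d)
    (hm : IsCom u v m) :
    ∃ m', IsCom u' v' m' ∧ m'.len = f.len - c.len - d.len + m.len := by
  rcases lt_trichotomy c.len d.len with h | h | h
  · obtain ⟨h1, m', h2, h3⟩ := hu.isCom_of_lt hv hrv hc hd h
    refine ⟨m', h2, ?_⟩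
    rw [hm.unique h1, h3]
    grind
  · obtain rfl := hc.isPrefix_left.eq_of_len_eq hd.isPrefix_left h
    obtain ⟨m', h2, h3⟩ := hu.isCom_of_eq hv hc hd hm
    refine ⟨m', h2, ?_⟩
    grind
  · obtain ⟨h1, m', h2, h3⟩ := hv.isCom_of_lt hu hru hd hc h
    refine ⟨m', h2.symm, ?_⟩
    rw [hm.symm.unique h1, h3]
    grind

/-- With `f⁻¹ = ca` and `u = cb = a⁻¹b`, lengths give `c = a⁻¹`. So `f = a⁻¹a`, which is reduced
only if `a` is empty. This yields freeness of the action. -/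
theorem IsProd.eq_nil (h : IsProd f u u) (hf : f.IsReduced) : f = nil := by
  obtain ⟨c, a, b, ha, rfl, -, hu⟩ := h
  have hl := congrArg len hu
  simp only [len_concat, len_inv] at hl
  obtain rfl : c = a.inv := (isPrefix_concat c b).eq_of_len_eq
    (hu ▸ isPrefix_concat _ _) (by rw [len_inv]; grind)
  have hfa : f = a.inv.concat a := by
    rw [← inv_inv f, ha, inv_concat, inv_inv]
  by_cases h0 : 0 < a.len
  · rw [hfa] at hf
    have hd := hf.diverge_inv h0
    rw [inv_inv] at hd
    obtain ⟨x, hx⟩ := exists_letter_unit h0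
    exact absurd hx (hd x hx)
  · have h1 : a.len = 0 := le_antisymm (not_lt.1 h0) a.len_nonneg
    exact eq_nil_of_len_eq_zero (by rw [hfa, len_concat, len_inv, h1, add_zero])

end ZWord

/-! ### The universal tree: hyperbolicity and the free isometric action. -/

namespace CDRSubgroup

variable {n : ℕ} [NeZero n] {X : Type*} {G : Type*} [Group G] {φ : CDRSubgroup n X G}

theorem word_one (φ : CDRSubgroup n X G) : φ.word 1 = ZWord.nil := by
  have h := φ.map_mul 1⁻¹ 1
  rw [φ.map_inv, inv_mul_cancel] at h
  exact h.unique (ZWord.isProd_inv_self _)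

namespace Tree

theorem isReduced (u : φ.Tree) : u.1.IsReduced := by
  obtain ⟨u, g, hu⟩ := u
  exact (φ.isCDR g).1.of_isPrefix hu

theorem Below.refl (u : φ.Tree) : u.Below u := ZWord.IsPrefix.refl _

theorem Below.trans {u v w : φ.Tree} (h : u.Below v) (h' : v.Below w) : u.Below w :=
  ZWord.IsPrefix.trans h h'

theorem Below.antisymm {u v : φ.Tree} (h : u.Below v) (h' : v.Below u) : u = v :=
  Subtype.ext (ZWord.IsPrefix.antisymm h h')

theorem base_below (u : φ.Tree) : (base φ).Below u := ZWord.nil_isPrefix _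

/-- Two vertices on the segment `[ε, w]` are comparable. -/
theorem Below.of_len_le {u v w : φ.Tree} (hu : u.Below w) (hv : v.Below w)
    (h : u.1.len ≤ v.1.len) : u.Below v := ZWord.IsPrefix.of_le hu hv h

theorem Below.eq_of_len_le {u v : φ.Tree} (hu : u.Below v) (h : v.1.len ≤ u.1.len) : u = v :=
  hu.antisymm ((Below.refl v).of_len_le hu h)

/-- The branching point of `[ε, u]` and `[ε, v]`. -/
noncomputable def com (u v : φ.Tree) : φ.Tree :=
  ⟨(u.exists_isCom v).choose, u.2.imp fun _ hg =>
    (u.exists_isCom v).choose_spec.isPrefix_left.trans hg⟩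

theorem isCom_com (u v : φ.Tree) : ZWord.IsCom u.1 v.1 (u.com v).1 :=
  (u.exists_isCom v).choose_spec

theorem dist_eq (u v : φ.Tree) : u.dist v = u.1.len + v.1.len - 2 • (u.com v).1.len := rfl

theorem com_below_left (u v : φ.Tree) : (u.com v).Below u := (isCom_com u v).isPrefix_left

theorem com_below_right (u v : φ.Tree) : (u.com v).Below v := (isCom_com u v).isPrefix_right

theorem below_com {u v w : φ.Tree} (hu : w.Below u) (hv : w.Below v) : w.Below (u.com v) :=
  (isCom_com u v).isPrefix hu hv

theorem com_comm (u v : φ.Tree) : u.com v = v.com u :=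
  Subtype.ext ((isCom_com u v).unique (isCom_com v u).symm)

theorem below_iff_len_com {u v : φ.Tree} : u.Below v ↔ (u.com v).1.len = u.1.len := by
  constructor
  · intro h
    exact le_antisymm (com_below_left u v).1 (below_com (Below.refl u) h).1
  · intro h
    rw [← (com_below_left u v).eq_of_len_le h.ge]
    exact com_below_right u v

theorem dist_comm (u v : φ.Tree) : u.dist v = v.dist u := by
  rw [dist_eq, dist_eq, com_comm, add_comm]

theorem Below.dist_eq {u v : φ.Tree} (h : u.Below v) : u.dist v = v.1.len - u.1.len := by
  rw [Tree.dist_eq, below_iff_len_com.1 h]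
  grind

theorem dist_base (u : φ.Tree) : (base φ).dist u = u.1.len := by
  rw [(base_below u).dist_eq]
  exact sub_zero _

theorem dist_nonneg (u v : φ.Tree) : 0 ≤ u.dist v := by
  have h1 := (com_below_left u v).1
  have h2 := (com_below_right u v).1
  rw [Tree.dist_eq]
  grind

theorem len_sub_len_le_dist (u v : φ.Tree) : v.1.len - u.1.len ≤ u.dist v := by
  have h1 := (com_below_left u v).1
  rw [Tree.dist_eq]
  grind

/-- `0`-hyperbolicity. -/
theorem len_com_le_or (u v w : φ.Tree) :
    (u.com v).1.len ≤ (u.com w).1.len ∨ (v.com w).1.len ≤ (u.com w).1.len := by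
  rcases le_total (u.com v).1.len (v.com w).1.len with h | h
  · have h1 := (com_below_right u v).of_len_le (com_below_left v w) h
    exact .inl (below_com (com_below_left u v) (h1.trans (com_below_right v w))).1
  · have h1 := (com_below_left v w).of_len_le (com_below_right u v) h
    exact .inr (below_com (h1.trans (com_below_left u v)) (com_below_right v w)).1

theorem below_iff_dist {u v : φ.Tree} :
    u.Below v ↔ (base φ).dist u + u.dist v = (base φ).dist v := by
  rw [below_iff_len_com, dist_base, dist_base, dist_eq]
  constructor <;> intro h <;> grind

theorem dist_triangle (u v w : φ.Tree) : u.dist w ≤ u.dist v + v.dist w := by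
  have h1 := (com_below_right u v).1
  have h2 := (com_below_left v w).1
  have h3 := len_com_le_or u v w
  simp only [dist_eq]
  grind

/-- If `y` does not lie on `[ε, a]` then it lies on `[a, u]` iff it lies on `[ε, u]`. -/
theorem dist_add_dist_iff_below {a y u : φ.Tree} (h : ¬ y.Below a) :
    a.dist y + y.dist u = a.dist u ↔ y.Below u := by
  rw [below_iff_len_com] at h ⊢
  rw [com_comm] at h
  have h1 := len_com_le_or a y u
  have h2 := (com_below_right a y).1
  have h3 := (com_below_left y u).1
  have h4 := len_com_le_or a u y
  rw [com_comm u y] at h4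
  simp only [dist_eq]
  constructor <;> intro h6 <;> grind

/-- A vertex between two vertices beyond `v` is itself beyond `v`. -/
theorem Below.of_dist_add_dist {v x y z : φ.Tree} (hx : v.Below x) (hy : v.Below y)
    (h : x.dist z + z.dist y = x.dist y) : v.Below z := by
  have h1 := (below_com hx hy).1
  have h2 := (com_below_left z y).1
  have h3 : v.1.len ≤ (x.com z).1.len := by
    simp only [Tree.dist_eq] at h
    grind
  exact (hx.of_len_le (com_below_left x z) h3).trans (com_below_right x z)

/-- The segments `[ε, u]` and `[ε, v]` agree at least up to length `|u| - d(u, v)`. -/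
theorem Below.of_add_dist_le {u v w : φ.Tree} (h : w.Below u)
    (hle : w.1.len + u.dist v ≤ u.1.len) : w.Below v := by
  have h1 := (com_below_right u v).1
  have h2 : w.1.len ≤ (u.com v).1.len := by
    simp only [Tree.dist_eq] at hle
    grind
  exact (h.of_len_le (com_below_left u v) h2).trans (com_below_right u v)

/-- The segment `[ε, w]` leaves `[ε, v]` before `u`, so the way from `w` to `v` covers `[u, v]`. -/
theorem len_sub_len_le_dist_of_not_below {u v w : φ.Tree} (h : u.Below v) (hw : ¬ u.Below w) :
    v.1.len - u.1.len ≤ w.dist v := by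
  have h1 : (w.com v).1.len < u.1.len := by
    by_contra! hle
    exact hw ((h.of_len_le (com_below_right w v) hle).trans (com_below_left w v))
  have h2 := (com_below_left w v).1
  rw [dist_eq]
  grind

/-! The action of `G`. -/

theorem isProd_smul (f : G) (u : φ.Tree) : ZWord.IsProd (φ.word f) u.1 (f • u).1 :=
  (exists_isProd f u).choose_spec

/-- The vertex `f · ε`. -/
def ofElem (φ : CDRSubgroup n X G) (f : G) : φ.Tree := ⟨φ.word f, f, ZWord.IsPrefix.refl _⟩

theorem smul_base (f : G) : f • base φ = ofElem φ f :=
  Subtype.ext ((isProd_smul f _).unique (ZWord.isProd_nil_right _))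

theorem smul_ofElem (f g : G) : f • ofElem φ g = ofElem φ (f * g) :=
  Subtype.ext ((isProd_smul f _).unique (φ.map_mul f g))

theorem len_smul (f : G) (u : φ.Tree) :
    (f • u).1.len = (φ.word f).len + u.1.len - 2 • ((ofElem φ f⁻¹).com u).1.len := by
  obtain ⟨c, hc, h⟩ := (isProd_smul f u).exists_isCom
  rw [← φ.map_inv] at hc
  rw [h, hc.unique (isCom_com (ofElem φ f⁻¹) u)]

theorem len_com_smul (f : G) (u v : φ.Tree) :
    ((f • u).com (f • v)).1.len = (φ.word f).len - ((ofElem φ f⁻¹).com u).1.len -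
      ((ofElem φ f⁻¹).com v).1.len + (u.com v).1.len := by
  have hu := isCom_com (ofElem φ f⁻¹) u
  have hv := isCom_com (ofElem φ f⁻¹) v
  change ZWord.IsCom (φ.word f⁻¹) _ _ at hu hv
  rw [φ.map_inv] at hu hv
  obtain ⟨m, hm, h⟩ := (isProd_smul f u).exists_isCom_len (isProd_smul f v) u.isReduced
    v.isReduced hu hv (isCom_com u v)
  rw [← h, (isCom_com (f • u) (f • v)).unique hm]

theorem dist_smul (f : G) (u v : φ.Tree) : (f • u).dist (f • v) = u.dist v := by
  rw [dist_eq, dist_eq, len_com_smul, len_smul, len_smul]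
  grind

/-- Each vertex lies on some segment `[ε, g · ε]`, where its distances to the two ends determine it.
-/
theorem eq_of_forall_dist {u v : φ.Tree}
    (h : ∀ g, u.dist (ofElem φ g) = v.dist (ofElem φ g)) : u = v := by
  obtain ⟨g, hg⟩ := u.2
  have hug : u.Below (ofElem φ g) := hg
  have h0 : u.1.len = v.1.len := by
    have := h 1
    rwa [← smul_base, show (1 : G) • base φ = base φ from
      (smul_base 1).trans (Subtype.ext (word_one φ)), dist_comm, dist_base, dist_comm,
      dist_base] at this
  have hvg : v.Below (ofElem φ g) := by
    have := h g
    rw [hug.dist_eq, dist_eq] at this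
    rw [below_iff_len_com]
    grind
  exact (hug.of_len_le hvg h0.le).eq_of_len_le h0.ge

noncomputable instance : MulAction G φ.Tree where
  one_smul u := Subtype.ext ((isProd_smul 1 u).unique (by
    rw [word_one]
    exact ZWord.isProd_nil_left _))
  -- Comparing distances to the orbit of `ε` avoids associativity of the partial product on words.
  mul_smul f k u := eq_of_forall_dist fun g => by
    have h : ∀ e, ofElem φ g = e • ofElem φ (e⁻¹ * g) := fun e => by
      rw [smul_ofElem, mul_inv_cancel_left]
    conv_lhs => rw [h (f * k), dist_smul]
    conv_rhs => rw [h f, dist_smul, show f⁻¹ * g = k * ((f * k)⁻¹ * g) by group,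
      ← smul_ofElem, dist_smul]

/-- The action of `G` on its universal tree is free. -/
theorem eq_one_of_smul_eq {f : G} {u : φ.Tree} (h : f • u = u) : f = 1 := by
  have hp := isProd_smul f u
  rw [h] at hp
  exact φ.injective ((hp.eq_nil (φ.isCDR f).1).trans (word_one φ).symm)

/-- Applying `f⁻¹`, the left side says that `f⁻¹ • v` lies on `[f⁻¹ • ε, u]`. As `f⁻¹ • v` is off
`[ε, f⁻¹ • ε]`, this means that it lies on `[ε, u]`. -/
theorem below_smul_iff {f : G} {u v : φ.Tree} (h : ¬ v.Below (f • base φ)) :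
    v.Below (f • u) ↔ (f⁻¹ • v).Below u := by
  have key : ∀ a b : φ.Tree, a.dist (f • b) = (f⁻¹ • a).dist b := fun a b => by
    rw [← dist_smul f⁻¹, inv_smul_smul]
  have h1 : ¬ (f⁻¹ • v).Below (f⁻¹ • base φ) := by
    intro h2
    apply h
    rw [below_iff_dist, key, key, ← dist_smul f⁻¹ (base φ) v,
      dist_comm (f⁻¹ • base φ) (f⁻¹ • v), dist_comm (f⁻¹ • v) (base φ),
      dist_comm (f⁻¹ • base φ) (base φ), add_comm]
    exact below_iff_dist.1 h2
  rw [below_iff_dist, key, key, ← dist_smul f⁻¹ (base φ) v, dist_add_dist_iff_below h1]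

end Tree

end CDRSubgroup

/-! ### The convex subgroup `ℤ¹`. -/

namespace ZLex

variable {n : ℕ} {a b : ZLex n}

theorem coord_nsmul (m : ℕ) (a : ZLex n) (i : Fin n) : (m • a).coord i = m * a.coord i := by
  induction m with
  | zero => simp
  | succ m ih =>
    rw [succ_nsmul, coord_add, ih]
    push_cast
    ring

theorem mem_convexSubgroup_one [NeZero n] : a ∈ convexSubgroup n 1 ↔ ∀ i : Fin n, 0 < i → a.coord i = 0 := by
  refine forall_congr' fun i => ?_
  rw [Fin.lt_def, Fin.val_zero, Nat.succ_le_iff]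

theorem convexSubgroup_one_of_le [NeZero n] (ha : 0 ≤ a) (hab : a ≤ b) (hb : b ∈ convexSubgroup n 1) :
    a ∈ convexSubgroup n 1 := by
  rw [mem_convexSubgroup_one] at hb ⊢
  rcases ha.eq_or_lt with rfl | ha
  · exact fun i _ => coord_zero i
  · obtain ⟨i, hi, hlt⟩ := lt_def.1 ha
    simp only [coord_zero] at hi hlt
    intro j hj
    by_contra hne
    have hij : j ≤ i := by
      by_contra! h
      exact hne (hi j h).symm
    refine not_lt.2 hab (lt_def.2 ⟨i, fun k hk => ?_, ?_⟩)
    · rw [hb k ((hj.trans_le hij).trans hk), hi k hk]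
    · rwa [hb i (hj.trans_le hij)]

theorem add_mem_convexSubgroup {k : ℕ} (ha : a ∈ convexSubgroup n k)
    (hb : b ∈ convexSubgroup n k) : a + b ∈ convexSubgroup n k := fun i hi => by
  rw [coord_add, ha i hi, hb i hi, add_zero]

theorem le_coord_zero [NeZero n] {m : ℕ} (ha : a ∈ convexSubgroup n 1) (h : m • unit n ≤ a) :
    (m : ℤ) ≤ a.coord 0 := by
  by_contra! hlt
  rw [mem_convexSubgroup_one] at ha
  refine not_lt.2 h (lt_def.2 ⟨0, fun j hj => ?_, ?_⟩)
  · rw [ha j hj, coord_nsmul, coord_unit_of_ne hj.ne', mul_zero]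
  · rwa [coord_nsmul, coord_unit_zero, mul_one]

end ZLex

/-! ### Geodesics and the metric of the compactification. -/

namespace CDRSubgroup

variable {n : ℕ} [NeZero n] {X : Type*} {G : Type*} [Group G] {φ : CDRSubgroup n X G}

theorem ZSubtree.dist_mem (S : φ.ZSubtree) {w z : φ.Tree} (hw : w ∈ S.1) (hz : z ∈ S.1) :
    w.dist z ∈ ZLex.convexSubgroup n 1 := by
  obtain ⟨S, u, rfl⟩ := S
  refine ZLex.convexSubgroup_one_of_le (Tree.dist_nonneg w z) (Tree.dist_triangle w u z)
    (ZLex.add_mem_convexSubgroup ?_ hz)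
  rw [Tree.dist_comm]
  exact hw

theorem ZSubtree.exists_mem (v : φ.Tree) : ∃ S : φ.ZSubtree, v ∈ S.1 :=
  ⟨⟨{u | v.dist u ∈ ZLex.convexSubgroup n 1}, v, rfl⟩, fun i _ => by
    rw [(Tree.Below.refl v).dist_eq, sub_self, ZLex.coord_zero]⟩

namespace Completion

variable {p q : φ.Completion} {u v z : φ.Tree}

theorem exists_above (hu : u ∈ p.carrier) (hv : v ∈ p.carrier) :
    ∃ x ∈ p.carrier, u.Below x ∧ v.Below x :=
  (p.linear u hu v hv).elim (fun h => ⟨v, hv, h, .refl v⟩) (fun h => ⟨u, hu, .refl u, h⟩)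

theorem below_of_len_le (hu : u ∈ p.carrier) (hv : v ∈ p.carrier) (h : u.1.len ≤ v.1.len) :
    u.Below v := by
  obtain ⟨x, -, hx, hx'⟩ := exists_above hu hv
  exact hx.of_len_le hx' h

theorem geodesic_comm (p q : φ.Completion) : p.geodesic q = q.geodesic p := by
  suffices h : ∀ p q : φ.Completion, p.geodesic q ⊆ q.geodesic p from (h p q).antisymm (h q p)
  rintro p q z ⟨x₀, hx₀, y₀, hy₀, H⟩
  refine ⟨y₀, hy₀, x₀, hx₀, fun y hy x hx h h' => ?_⟩
  rw [y.dist_comm z, z.dist_comm x, y.dist_comm x, add_comm]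
  exact H x hx y hy h' h

theorem mem_geodesic_of_not_mem (hp : v ∉ p.carrier) (hq : v ∈ q.carrier) :
    v ∈ p.geodesic q := by
  refine ⟨_, p.base_mem, v, hq, fun x hx y hy _ hvy => ?_⟩
  have h : ¬ v.Below x := fun h => hp (p.mem_of_below _ _ h hx)
  rw [x.dist_comm v, x.dist_comm y, Tree.dist_comm v y, add_comm]
  rw [← Tree.dist_add_dist_iff_below h] at hvy
  rw [y.dist_comm v, y.dist_comm x, v.dist_comm x, add_comm]
  exact hvy

theorem below_of_mem_geodesic (hp : v ∈ p.carrier) (hq : v ∈ q.carrier)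
    (hz : z ∈ p.geodesic q) : v.Below z := by
  obtain ⟨x₀, hx₀, y₀, hy₀, H⟩ := hz
  obtain ⟨x, hx, hvx, hx'⟩ := exists_above hp hx₀
  obtain ⟨y, hy, hvy, hy'⟩ := exists_above hq hy₀
  exact Tree.Below.of_dist_add_dist hvx hvy (H x hx y hy hx' hy')

variable {D : φ.MetricData} {S : φ.ZSubtree}

theorem exp_le_exp_of_le {m : ℕ} (hz : z ∈ S.1)
    (h : m • ZLex.unit n ≤ (D.basePoint S).dist z) :
    Real.exp (-(((D.basePoint S).dist z).coord 0 : ℝ)) ≤ Real.exp (-m) := by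
  rw [Real.exp_le_exp, neg_le_neg_iff]
  exact_mod_cast ZLex.le_coord_zero (S.dist_mem (D.basePoint_mem S) hz) h

theorem exp_le_one (hz : z ∈ S.1) :
    Real.exp (-(((D.basePoint S).dist z).coord 0 : ℝ)) ≤ 1 := by
  have := exp_le_exp_of_le (D := D) (m := 0) hz (by
    rw [zero_nsmul]
    exact Tree.dist_nonneg _ _)
  simpa using this

theorem distIn_nonneg (D : φ.MetricData) (S : φ.ZSubtree) (p q : φ.Completion) :
    0 ≤ distIn D S p q := by
  refine Real.sSup_nonneg ?_
  rintro _ ⟨z, -, rfl⟩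
  exact Real.exp_nonneg _

theorem distIn_le_one (D : φ.MetricData) (S : φ.ZSubtree) (p q : φ.Completion) :
    distIn D S p q ≤ 1 := by
  refine Real.sSup_le ?_ zero_le_one
  rintro _ ⟨z, hz, rfl⟩
  exact exp_le_one hz.1

theorem le_distIn (hz : z ∈ S.1) (hz' : z ∈ p.geodesic q) :
    Real.exp (-(((D.basePoint S).dist z).coord 0 : ℝ)) ≤ distIn D S p q := by
  refine le_csSup ⟨1, ?_⟩ ⟨z, ⟨hz, hz'⟩, rfl⟩
  rintro _ ⟨y, hy, rfl⟩
  exact exp_le_one hy.1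

theorem summable_distIn (D : φ.MetricData) (p q : φ.Completion) :
    Summable fun S => D.scale S * distIn D S p q :=
  D.summable_scale.of_nonneg_of_le
    (fun S => mul_nonneg (D.scale_pos S).le (distIn_nonneg D S p q))
    (fun S => mul_le_of_le_one_right (D.scale_pos S).le (distIn_le_one D S p q))

theorem metric_comm (D : φ.MetricData) (p q : φ.Completion) : metric D p q = metric D q p := by
  simp only [metric, distIn, geodesic_comm p q]
  by_cases h : p = q
  · rw [if_pos h, if_pos h.symm]
  · rw [if_neg h, if_neg (Ne.symm h)]

/-- This matters for `p = q`: the series is positive if `p` is a vertex, as the vertex itself then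
lies in `p.geodesic p`. -/
theorem metric_le_tsum (D : φ.MetricData) (p q : φ.Completion) :
    metric D p q ≤ ∑' S, D.scale S * distIn D S p q := by
  rw [metric]
  split_ifs
  · exact tsum_nonneg fun S => mul_nonneg (D.scale_pos S).le (distIn_nonneg D S p q)
  · exact le_rfl

/-- Points separated by the vertex `v` are not close to each other. -/
theorem exists_le_metric (D : φ.MetricData) (v : φ.Tree) :
    ∃ δ > 0, ∀ p q : φ.Completion, v ∉ p.carrier → v ∈ q.carrier → δ ≤ metric D p q := by
  obtain ⟨S, hS⟩ := ZSubtree.exists_mem v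
  -- A single summand suffices: `v` lies on `[p, q]`, so the `ℤ`-subtree of `v` contributes at least
  -- this much.
  refine ⟨D.scale S * Real.exp (-(((D.basePoint S).dist v).coord 0 : ℝ)),
    mul_pos (D.scale_pos S) (Real.exp_pos _), fun p q hp hq => ?_⟩
  have hne : p ≠ q := by
    rintro rfl
    exact hp hq
  rw [metric, if_neg hne]
  refine le_trans ?_ ((summable_distIn D p q).le_tsum S fun T _ =>
    mul_nonneg (D.scale_pos T).le (distIn_nonneg D T p q))
  exact mul_le_mul_of_nonneg_left (le_distIn hS (mem_geodesic_of_not_mem hp hq))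
    (D.scale_pos S).le

end Completion

/-! ### Shadows and the topology at ends of `ℤⁿ`-type. -/

namespace Compactification

variable {D : φ.MetricData}

/-- The points of `Γ̄_G` that are separated from `ε` by the vertex `v`. -/
def shadow (D : φ.MetricData) (v : φ.Tree) : Set (φ.Compactification D) :=
  {p | v ∈ Completion.carrier (φ := φ) p}

/-- Being clopen, a shadow has a continuous indicator, which can be tested against weak convergence.
-/
theorem isClopen_shadow (D : φ.MetricData) (v : φ.Tree) : IsClopen (shadow D v) := by
  obtain ⟨δ, hδ, H⟩ := Completion.exists_le_metric D v
  constructor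
  · rw [← isOpen_compl_iff]
    refine fun p hp => ⟨δ, hδ, fun q hq hvq => ?_⟩
    exact not_lt.2 (H p q hp hvq) hq
  · refine fun p hp => ⟨δ, hδ, fun q hq => ?_⟩
    by_contra hvq
    exact not_lt.2 (H q p hvq hp) ((Completion.metric_comm D q p).trans_lt hq)

theorem shadow_base (D : φ.MetricData) : shadow D (Tree.base φ) = Set.univ :=
  Set.eq_univ_of_forall fun p => Completion.base_mem (φ := φ) p

theorem shadow_anti (D : φ.MetricData) {u v : φ.Tree} (h : u.Below v) :
    shadow D v ⊆ shadow D u := fun p hp => Completion.mem_of_below (φ := φ) p _ _ h hp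

/-- The shadows of the vertices on `[ε, ω)` form a neighborhood base at an end `ω` of
`ℤⁿ`-type. -/
theorem tendsto_of_eventually_mem_shadow {ι : Type*} {l : Filter ι}
    {q : ι → φ.Compactification D} {ω : φ.Compactification D}
    (hω : ∀ α, ∃ v : φ.Tree, ω ∈ shadow D v ∧ α ≤ v.1.len)
    (h : ∀ v, ω ∈ shadow D v → ∀ᶠ i in l, q i ∈ shadow D v) : Tendsto q l (𝓝 ω) := by
  have hlim : Tendsto (fun i => ∑' S, D.scale S * Completion.distIn D S ω (q i)) l
      (𝓝 (∑' _ : φ.ZSubtree, 0)) := by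
    refine tendsto_tsum_of_dominated_convergence D.summable_scale (fun S => ?_)
      (Eventually.of_forall fun i S => ?_)
    · rw [← mul_zero (D.scale S)]
      refine Tendsto.const_mul _ (tendsto_order.2 ⟨fun a ha => Eventually.of_forall fun i =>
        ha.trans_le (Completion.distIn_nonneg D S _ _), fun η hη => ?_⟩)
      obtain ⟨m, hm⟩ := ((Real.tendsto_exp_neg_atTop_nhds_zero.comp
        tendsto_natCast_atTop_atTop).eventually (gt_mem_nhds hη)).exists
      -- Once `q i` is beyond `v`, so is all of `[ω, q i]`, and its vertices in `S` are at distance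
      -- at least `m` from `w_S`.
      obtain ⟨v, hv, hlen⟩ := hω ((D.basePoint S).1.len + m • ZLex.unit n)
      filter_upwards [h v hv] with i hi
      refine lt_of_le_of_lt (Real.sSup_le ?_ (Real.exp_nonneg (-m))) hm
      rintro _ ⟨z, ⟨hzS, hz⟩, rfl⟩
      refine Completion.exp_le_exp_of_le hzS ?_
      have h1 := (Completion.below_of_mem_geodesic hv hi hz).1
      have h2 := Tree.len_sub_len_le_dist (D.basePoint S) z
      grind
    · refine (Real.norm_of_nonneg
        (mul_nonneg (D.scale_pos S).le (Completion.distIn_nonneg D S _ _))).trans_le ?_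
      exact mul_le_of_le_one_right (D.scale_pos S).le (Completion.distIn_le_one D S _ _)
  rw [tsum_zero] at hlim
  refine tendsto_nhds.2 fun U hU hωU => ?_
  obtain ⟨δ, hδ, H⟩ := hU ω hωU
  filter_upwards [hlim.eventually (gt_mem_nhds hδ)] with i hi
  exact H _ ((Completion.metric_le_tsum D ω (q i)).trans_lt hi)

end Compactification

end CDRSubgroup

/-! ### Stabilizers of ends of `ℤⁿ`-type. -/

namespace CDRSubgroup

variable {n : ℕ} [NeZero n] {X : Type*} {G : Type*} [Group G] {φ : CDRSubgroup n X G}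

namespace Completion

variable {ξ : φ.Completion}

/-- An element that fixes an end of `ℤⁿ`-type acts as a translation near this end. -/
theorem exists_translation_of_smul_eq (hξ : ∀ α, ∃ y ∈ ξ.carrier, α ≤ y.1.len) {g : G}
    (hg : g • ξ = ξ) :
    ∃ τ t : ZLex n, ∀ u ∈ ξ.carrier, t ≤ u.1.len →
      g • u ∈ ξ.carrier ∧ (g • u).1.len = u.1.len + τ := by
  -- Beyond length `|g⁻¹|` on the ray, the branching point with `g⁻¹` no longer changes, so the
  -- length shift is constant.
  obtain ⟨u₀, hu₀, hlen⟩ := hξ (φ.word g⁻¹).len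
  have hcom : ∀ u ∈ ξ.carrier, u₀.1.len ≤ u.1.len →
      (Tree.ofElem φ g⁻¹).com u = (Tree.ofElem φ g⁻¹).com u₀ := by
    intro u hu hle
    have h₀ := below_of_len_le hu₀ hu hle
    have h1 := Tree.com_below_left (Tree.ofElem φ g⁻¹) u
    have h2 := Tree.com_below_right (Tree.ofElem φ g⁻¹) u
    exact (Tree.below_com h1 (h2.of_len_le h₀ (h1.1.trans hlen))).antisymm
      (Tree.below_com (Tree.com_below_left _ _) ((Tree.com_below_right _ _).trans h₀))
  refine ⟨(φ.word g).len - 2 • ((Tree.ofElem φ g⁻¹).com u₀).1.len, u₀.1.len,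
    fun u hu hle => ⟨?_, ?_⟩⟩
  · rw [← hg]
    refine ⟨u, hu, fun y hy huy => ?_⟩
    rw [Tree.below_iff_len_com, Tree.len_com_smul, Tree.len_smul, hcom u hu hle,
      hcom y hy (hle.trans huy.1), Tree.below_iff_len_com.1 huy]
    grind
  · rw [Tree.len_smul, hcom u hu hle]
    grind

/-- The stabilizer of an end of `ℤⁿ`-type is abelian. -/
theorem commute_of_smul_eq (hξ : ∀ α, ∃ y ∈ ξ.carrier, α ≤ y.1.len) {f k : G}
    (hf : f • ξ = ξ) (hk : k • ξ = ξ) : Commute f k := by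
  obtain ⟨τ, t, Hf⟩ := exists_translation_of_smul_eq hξ hf
  obtain ⟨σ, s, Hk⟩ := exists_translation_of_smul_eq hξ hk
  -- The bounds keep `u`, `f • u` and `k • u` in the range where the next element acts as a
  -- translation.
  obtain ⟨u, hu, hle⟩ := hξ (max (max t s) (max (t - σ) (s - τ)))
  simp only [max_le_iff] at hle
  obtain ⟨⟨h1, h2⟩, h3, h4⟩ := hle
  obtain ⟨hfu, hfl⟩ := Hf u hu h1
  obtain ⟨hku, hkl⟩ := Hk u hu h2
  obtain ⟨hfk, hfkl⟩ := Hf _ hku (by grind)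
  obtain ⟨hkf, hkfl⟩ := Hk _ hfu (by grind)
  have hl : (f • k • u).1.len = (k • f • u).1.len := by grind
  -- Both vertices lie on the ray of `ξ` at length `|u| + τ + σ`.
  have heq : f • k • u = k • f • u :=
    (below_of_len_le hfk hkf hl.le).eq_of_len_le hl.ge
  rw [← mul_smul, ← mul_smul, ← inv_smul_eq_iff, ← mul_smul] at heq
  exact (inv_mul_eq_one.1 (Tree.eq_one_of_smul_eq heq)).symm

end Completion

/-! ### Concentration and stationarity of the measure. -/

namespace Compactification

variable {D : φ.MetricData}

theorem smul_mem_shadow_iff {g : G} {v : φ.Tree} (h : ¬ v.Below (g • Tree.base φ))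
    (p : φ.Compactification D) : g • p ∈ shadow D v ↔ p ∈ shadow D (g⁻¹ • v) := by
  constructor
  · rintro ⟨y, hy, H⟩
    exact Completion.mem_of_below (φ := φ) p _ _
      ((Tree.below_smul_iff h).1 (H y hy (.refl y))) hy
  · intro hp
    exact ⟨_, hp, fun y _ hvy => (Tree.below_smul_iff h).2 hvy⟩

theorem exists_mem_shadow_of_mem_topEnds {ω : φ.Compactification D} (hω : ω ∈ topEnds φ D)
    (α : ZLex n) : ∃ v : φ.Tree, ω ∈ shadow D v ∧ α ≤ v.1.len := by
  obtain ⟨v, -, r, hr, hv, hrange⟩ := hω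
  have hmem : ∀ a : ZLex n, a ∈ ZLex.convexSubgroup n n :=
    fun a i hi => absurd i.2 (not_lt.2 hi)
  -- Type `n` is essential: `ℤⁿ` imposes no bound on the parameter, so the ray reaches every length.
  let a : {a : ZLex n // 0 ≤ a ∧ a ∈ ZLex.convexSubgroup n n} :=
    ⟨max α 0, le_max_right _ _, hmem _⟩
  have h : r a ∈ {u | u ∈ Completion.carrier (φ := φ) ω ∧ v.Below u} := hrange ▸ ⟨a, rfl⟩
  refine ⟨r a, h.1, ?_⟩
  have h1 := hr ⟨0, le_rfl, hmem _⟩ a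
  rw [hv _ rfl, h.2.dist_eq, zero_sub, abs_neg, abs_of_nonneg a.2.1] at h1
  have h2 := v.1.len_nonneg
  have h3 : α ≤ a.1 := le_max_left _ _
  grind

theorem eventually_lt_measureReal {ν : Measure (φ.Compactification D)} {g : ℕ → G}
    {ω : φ.Compactification D}
    (hconv : WeaklyConverges (fun i => translate (g i) ν) (Measure.dirac ω)) {v : φ.Tree}
    (hv : ω ∈ shadow D v) {η : ℝ} (hη₀ : 0 ≤ η) (hη : η < 1) :
    ∀ᶠ i in atTop, η < ν.real {p | g i • p ∈ shadow D v} := by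
  have hclopen := isClopen_shadow D v
  have hmeas : MeasurableSet (shadow D v) := hclopen.isOpen.measurableSet
  let F : φ.Compactification D →ᵇ ℝ :=
    BoundedContinuousFunction.indicator (shadow D v) hclopen
  have hF : ∀ κ : Measure (φ.Compactification D), ∫ p, F p ∂κ = κ.real (shadow D v) :=
    fun κ => integral_indicator_one hmeas
  have h := hconv F
  simp only [hF] at h
  have h1 : (Measure.dirac ω).real (shadow D v) = 1 := by
    rw [measureReal_def, Measure.dirac_apply' _ hmeas, Set.indicator_of_mem hv]
    simp
  rw [h1] at h
  filter_upwards [h.eventually (lt_mem_nhds hη)] with i hi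
  -- Without a.e. measurability, `Measure.map` is the zero measure, whose mass cannot exceed `η ≥
  -- 0`.
  by_cases hm : AEMeasurable (fun p : φ.Compactification D => g i • p) ν
  · rwa [translate, measureReal_def, Measure.map_apply_of_aemeasurable hm hmeas] at hi
  · rw [translate, Measure.map_of_not_aemeasurable hm] at hi
    simp only [measureReal_zero, Pi.zero_apply] at hi
    exact absurd hi (not_lt.2 hη₀)

/-- Two shadows of mass above `1/2` meet, so their vertices are comparable and such vertices form a
ray. Its shadows have full mass and intersect exactly in its end. -/
theorem exists_end_of_shadows (ν : Measure (φ.Compactification D)) [IsProbabilityMeasure ν]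
    (h : ∀ (α : ZLex n) (η : ℝ), 0 ≤ η → η < 1 →
      ∃ y : φ.Tree, α ≤ y.1.len ∧ η < ν.real (shadow D y)) :
    ∃ ξ : φ.Compactification D, (∀ α, ∃ y : φ.Tree, ξ ∈ shadow D y ∧ α ≤ y.1.len) ∧
      MeasurableSet {ξ} ∧ ∀ᵐ p ∂ν, p = ξ := by
  have hmeas : ∀ v, MeasurableSet (shadow D v) := fun v =>
    (isClopen_shadow D v).isOpen.measurableSet
  let ξ : φ.Completion :=
    { carrier := {u | 1 / 2 < ν.real (shadow D u)}
      base_mem := by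
        rw [Set.mem_ofPred_eq, shadow_base, probReal_univ]
        norm_num
      mem_of_below := fun u v huv hv => lt_of_lt_of_le hv (measureReal_mono (shadow_anti D huv))
      linear := by
        intro u hu v hv
        obtain ⟨p, hpu, hpv⟩ : (shadow D u ∩ shadow D v).Nonempty := by
          by_contra hne
          have hd : Disjoint (shadow D u) (shadow D v) :=
            Set.disjoint_iff_inter_eq_empty.2 (Set.not_nonempty_iff_eq_empty.1 hne)
          have h1 := measureReal_union (μ := ν) hd (hmeas v)
          have h2 : ν.real (shadow D u ∪ shadow D v) ≤ 1 := measureReal_le_one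
          simp only [Set.mem_ofPred_eq] at hu hv
          linarith
        exact Completion.linear (φ := φ) p u hpu v hpv }
  have hcof : ∀ α, ∃ y ∈ ξ.carrier, α ≤ y.1.len := fun α => by
    obtain ⟨y, h1, h2⟩ := h α (1 / 2) (by norm_num) (by norm_num)
    exact ⟨y, h2, h1⟩
  have hfull : ∀ u ∈ ξ.carrier, ∀ᵐ p ∂ν, p ∈ shadow D u := by
    intro u hu
    refine (prob_compl_eq_zero_iff (hmeas u)).2 ((ENNReal.toReal_eq_one_iff _).1
      (le_antisymm measureReal_le_one (le_of_forall_lt fun η hη => ?_)))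
    -- Mass above `1/2` puts `y` on the ray, hence beyond `u`; mass above `η` then passes to the
    -- shadow of `u`.
    obtain ⟨y, hy, hlt⟩ := h u.1.len (max η (1 / 2)) (by positivity) (max_lt hη (by norm_num))
    rw [max_lt_iff] at hlt
    exact hlt.1.trans_le
      (measureReal_mono (shadow_anti D (Completion.below_of_len_le hu hlt.2 hy)))
  -- Length is injective on a ray and `ℤⁿ` is countable, so the shadows along the ray can be
  -- intersected almost everywhere.
  have hcount : ξ.carrier.Countable :=
    Set.MapsTo.countable_of_injOn (f := fun u => u.1.len) (t := Set.univ) (fun _ _ => trivial)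
      (fun u hu v hv huv => (Completion.below_of_len_le hu hv huv.le).eq_of_len_le huv.ge)
      (Set.to_countable _)
  have hset : ({ξ} : Set (φ.Compactification D)) = ⋂ u ∈ ξ.carrier, shadow D u := by
    refine Set.Subset.antisymm ?_ ?_
    · rintro _ rfl
      exact Set.mem_iInter₂.2 fun u hu => hu
    · intro p hp
      rw [Set.mem_iInter₂] at hp
      refine Completion.ext (Set.Subset.antisymm (fun z hz => ?_) hp)
      obtain ⟨y, hy, hzy⟩ := hcof z.1.len
      exact ξ.mem_of_below _ _ (Completion.below_of_len_le hz (hp y hy) hzy) hy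
  have hξ : MeasurableSet ({ξ} : Set (φ.Compactification D)) := by
    rw [hset]
    exact MeasurableSet.biInter hcount fun u _ => hmeas u
  refine ⟨ξ, fun α => hcof α, hξ, ?_⟩
  · filter_upwards [(ae_ball_iff hcount).2 hfull] with p hp
    exact (hset ▸ Set.mem_iInter₂.2 hp : p ∈ ({ξ} : Set (φ.Compactification D)))

/-- The complement of `ξ` is null for the sum of the translates, hence for each translate of
positive weight. -/
theorem smul_eq_of_isStationary {μ : PMF G} {ν : Measure (φ.Compactification D)}
    [IsProbabilityMeasure ν] (hstat : IsStationary μ ν) {ξ : φ.Compactification D}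
    (hmeas : MeasurableSet {ξ}) (hξ : ∀ᵐ p ∂ν, p = ξ) {g : G} (hg : g ∈ μ.support) :
    g • ξ = ξ := by
  -- As `ν` is concentrated at `ξ`, the map agrees a.e. with a constant.
  have hae : AEMeasurable (fun p : φ.Compactification D => g • p) ν := by
    refine ⟨fun _ => g • ξ, measurable_const, ?_⟩
    filter_upwards [hξ] with p hp
    rw [hp]
  have h0 : ν {ξ}ᶜ = 0 := hξ
  rw [← hstat, Measure.sum_apply _ hmeas.compl, ENNReal.tsum_eq_zero] at h0
  have h1 := h0 g
  rw [Measure.smul_apply, smul_eq_mul, mul_eq_zero, or_iff_right ((μ.mem_support_iff g).1 hg),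
    translate, Measure.map_apply_of_aemeasurable hae hmeas.compl] at h1
  have h2 : ∀ᵐ p ∂ν, g • p = ξ := h1
  obtain ⟨p, hp, hgp⟩ := (hξ.and h2).exists
  rwa [hp] at hgp

end Compactification

end CDRSubgroup

/-! ### The convergence theorem. -/

open CDRSubgroup Compactification in
theorem mainTheorem8 {n : ℕ} [NeZero n] {X : Type*} {G : Type*} [Group G]
    (hfg : Group.FG G) (hnonab : ∃ a b : G, a * b ≠ b * a)
    (φ : CDRSubgroup n X G) (hirr : φ.IsIrreducible) (D : φ.MetricData)
    (μ : PMF G) (hμ : Subsemigroup.closure μ.support = ⊤)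
    (ν : Measure (φ.Compactification D)) (hprob : IsProbabilityMeasure ν)
    (hstat : CDRSubgroup.IsStationary μ ν)
    (ω : φ.Compactification D) (hω : ω ∈ CDRSubgroup.Compactification.topEnds φ D)
    (g : ℕ → G)
    (hconv : CDRSubgroup.WeaklyConverges (fun i => CDRSubgroup.translate (g i) ν)
      (Measure.dirac ω))
    (x : φ.Tree) :
    Tendsto (fun i => (CDRSubgroup.Compactification.ofVertex (g i • x) : φ.Compactification D))
      atTop (𝓝 ω) := by
  have hcof := exists_mem_shadow_of_mem_topEnds hω
  refine tendsto_of_eventually_mem_shadow hcof fun v₀ hv₀ => ?_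
  by_contra hnot
  -- Since `g i • x` is at distance `|x|` from `g i • ε`, this margin puts it beyond `v₀` whenever
  -- `g i • ε` is beyond `v₁`.
  obtain ⟨v₁, hv₁, hlen₁⟩ := hcof (v₀.1.len + x.1.len)
  have hfreq : ∃ᶠ i in atTop, ¬ v₁.Below (g i • Tree.base φ) := by
    refine (not_eventually.1 hnot).mono fun i hi hb => hi ?_
    have h₀ : v₀.Below (g i • Tree.base φ) :=
      (Completion.below_of_len_le hv₀ hv₁
        ((le_add_of_nonneg_right x.1.len_nonneg).trans hlen₁)).trans hb
    exact h₀.of_add_dist_le (by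
      rw [Tree.dist_smul, Tree.dist_base]
      exact hlen₁.trans hb.1)
  obtain ⟨ξ, hξ, hmeas, hae⟩ := exists_end_of_shadows ν (by
    intro α η hη₀ hη
    -- The first bound puts `v` beyond `v₁`; the second gives `|(g i)⁻¹ • v| = d(g i • ε, v) ≥ |v| -
    -- |v₁| ≥ α`.
    obtain ⟨v, hv, hlen⟩ := hcof (max v₁.1.len (α + v₁.1.len))
    rw [max_le_iff] at hlen
    have hv₁v : v₁.Below v := Completion.below_of_len_le hv₁ hv hlen.1
    obtain ⟨i, hi, hlt⟩ :=
      (hfreq.and_eventually (eventually_lt_measureReal hconv hv hη₀ hη)).exists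
    refine ⟨(g i)⁻¹ • v, ?_, ?_⟩
    · rw [← Tree.dist_base, ← Tree.dist_smul (g i), smul_inv_smul]
      exact (le_sub_iff_add_le.2 hlen.2).trans (Tree.len_sub_len_le_dist_of_not_below hv₁v hi)
    · rwa [show shadow D ((g i)⁻¹ • v) = {p | g i • p ∈ shadow D v} from
        Set.ext fun p => (smul_mem_shadow_iff (fun h => hi (hv₁v.trans h)) p).symm])
  obtain ⟨a, b, hab⟩ := hnonab
  -- Only elements of the support need to fix `ξ`: commutation passes to products.
  have hcomm : ∀ f k : G, f ∈ Subsemigroup.closure μ.support →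
      k ∈ Subsemigroup.closure μ.support → Commute f k := fun f k hf hk =>
    Subsemigroup.closure_induction₂ (p := fun f k _ _ => Commute f k)
      (fun f k hf hk => Completion.commute_of_smul_eq (ξ := ξ) hξ
        (smul_eq_of_isStationary hstat hmeas hae hf) (smul_eq_of_isStationary hstat hmeas hae hk))
      (fun _ _ _ _ _ _ h h' => h.mul_left h') (fun _ _ _ _ _ _ h h' => h.mul_right h') hf hk
  rw [hμ] at hcomm
  exact hab (hcomm a b trivial trivial)
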